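/- A Lawvere theory is a small category $L$ whose objects are the natural numbers, together with an identity-on-objects functor $\aleph_0\to L$ strictly preserving the finite coproducts $(+,0)$; here $\aleph_0$ is the category of the finite sets $\underline n=\{0,\dots,n-1\}$ and all functions. Morphisms of Lawvere theories are identity-on-objects functors strictly preserving finite coproducts. $L$ is symmetric monoidal if it carries a symmetric monoidal structure strictly preserved by $\aleph_0\to L$, where $\aleph_0$ has the tensor $n\otimes m=n\cdot m$ with unit $1$ given by the coordinatisation $\underline{n\cdot m}\cong\underline n\times\underline m$, $a\cdot m+b\leftrightarrow(a,b)$. Let $\mathbf{SMBLaw}$ be the category of symmetric monoidal Lawvere theories in which $(+,0)$ are biproducts, with morphisms of Lawvere theories strictly preserving the tensor (they then also strictly preserve the biproduct projections). A monad $(T,\eta,\mu)$ on $\mathbf{Sets}$ is commutative if $\mu\circ T(\mathsf{st}')\circ\mathsf{st}=\mu\circ T(\mathsf{st})\circ\mathsf{st}'\colon T(X)\times T(Y)\to T(X\times Y)$ for all $X,Y$, where $\mathsf{st}(t,y)=T(x\mapsto(x,y))(t)$ and $\mathsf{st}'(x,t)=T(y\mapsto(x,y))(t)$. It is additive if $T(\emptyset)\cong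 1$ and, for all $X,Y$, the map $\langle\mu\circ T([\eta,0]),\mu\circ T([0,\eta])\rangle\colon T(X+Y)\to T(X)\times T(Y)$ is a bijection, where $0$ denotes the zero maps $A\to 1\cong T(\emptyset)\to T(B)$. Let $\mathbf{ACMnd}$ be the category of additive commutative monads on $\mathbf{Sets}$ and monad morphisms. For a Lawvere theory $L$ let $T_L$ be the monad on $\mathbf{Sets}$ with $$T_L(X)=\Big(\coprod_{i\in\mathbb N}L(1,i)\times X^i\Big)/\!\sim,$$ where $\sim$ is the least equivalence relation with $\kappa_m(f\circ g,v)\sim\kappa_i(g,v\circ f)$ for all $f\colon \underline i\to \underline m$ in $\aleph_0$, $g\in L(1,i)$, $v\in X^m$ (writing $f$ also for its image in $L$). Its unit is $x\mapsto[\kappa_1(\mathrm{id}_1,x)]$, and its multiplication sends $[\kappa_i(g,v)]$, with $v(a)=[\kappa_{j_a}(g_a,v_a)]$ for $a<i$, to $[\kappa_j((g_0+\cdots+g_{i-1})\circ g,[v_0,\dots,v_{i-1}])]$, where $j=j_0+\cdots+j_{i-1}$. A morphism $F\colon L\to K$ induces the monad morphism $[\kappa_i(g,v)]\mapsto[\kappa_i(F(g),v)]$;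 this gives a functor $\mathcal T$ from Lawvere theories to monads on $\mathbf{Sets}$. For $T\in\mathbf{ACMnd}$ let $\mathcal{K}\ell_{\mathbb N}(T)\in\mathbf{SMBLaw}$ be the finitary Kleisli category: maps $n\to m$ are functions $\underline n\to T(\underline m)$, composition is Kleisli composition, and the tensor of $f\colon n\to p$ and $g\colon m\to q$ is $\underline{n\cdot m}\cong\underline n\times\underline m\xrightarrow{f\times g}T(\underline p)\times T(\underline q)\to T(\underline p\times\underline q)\cong T(\underline{p\cdot q})$, with the common composite from the definition of commutativity in the middle; a monad morphism $\sigma$ acts by $f\mapsto\sigma\circ f$. **Lemma.** If $L$ is a symmetric monoidal Lawvere theory with biproducts, then the monad $T_L$ is additive and commutative. Hence $\mathcal T$ restricts to a functor $\mathcal T\colon\mathbf{SMBLaw}\to\mathbf{ACMnd}$. This functor is left adjoint to the finitary Kleisli functor $\mathcal{K}\ell_{\mathbb N}\colon\mathbf{ACMnd}\to\mathbf{SMBLaw}$. -/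

import Mathlib

open CategoryTheory

universe u

/-! ### Lawvere theories -/

/-- A Lawvere theory: a small category with the natural numbers as objects, together with an
identity-on-objects functor `ι` from the category of the finite sets `{0, …, n-1}` and functions,
such that `0` is initial and `n + m`, with the images of the two coprojections
`Fin n → Fin (n + m) ← Fin m`, is a coproduct of `n` and `m`.
`comp f g` is "first `f`, then `g`". -/
structure Law : Type (u + 1) where
  Hom : ℕ → ℕ → Type u
  id : ∀ n, Hom n n
  comp : ∀ {n m k}, Hom n m → Hom m k → Hom n k
  id_comp : ∀ {n m} (f : Hom n m), comp (id n) f = f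
  comp_id : ∀ {n m} (f : Hom n m), comp f (id m) = f
  assoc : ∀ {n m k l} (f : Hom n m) (g : Hom m k) (h : Hom k l),
    comp (comp f g) h = comp f (comp g h)
  ι : ∀ {n m}, (Fin n → Fin m) → Hom n m
  ι_id : ∀ n, ι (fun i : Fin n => i) = id n
  ι_comp : ∀ {n m k} (f : Fin n → Fin m) (g : Fin m → Fin k),
    ι (fun i => g (f i)) = comp (ι f) (ι g)
  initial : ∀ m, ∃! _f : Hom 0 m, True
  coproduct : ∀ {n m k} (f : Hom n k) (g : Hom m k),
    ∃! h : Hom (n + m) k, comp (ι (Fin.castAdd m)) h = f ∧ comp (ι (Fin.natAdd n)) h = g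

/-- A morphism of Lawvere theories: an identity-on-objects functor that strictly preserves the
finite coproducts. -/
@[ext]
structure LawHom (L K : Law.{u}) : Type u where
  map : ∀ {n m}, L.Hom n m → K.Hom n m
  map_id : ∀ n, map (L.id n) = K.id n
  map_comp : ∀ {n m k} (f : L.Hom n m) (g : L.Hom m k),
    map (L.comp f g) = K.comp (map f) (map g)
  map_inl : ∀ n m, map (L.ι (Fin.castAdd (n := n) m)) = K.ι (Fin.castAdd m)
  map_inr : ∀ n m, map (L.ι (Fin.natAdd (m := m) n)) = K.ι (Fin.natAdd n)

instance : Category Law.{u} where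
  Hom := LawHom
  id L :=
    { map := fun f => f, map_id := fun _ => rfl, map_comp := fun _ _ => rfl
      map_inl := fun _ _ => rfl, map_inr := fun _ _ => rfl }
  comp F G :=
    { map := fun f => G.map (F.map f)
      map_id := fun n => by rw [F.map_id, G.map_id]
      map_comp := fun f g => by rw [F.map_comp, G.map_comp]
      map_inl := fun n m => by rw [F.map_inl, G.map_inl]
      map_inr := fun n m => by rw [F.map_inr, G.map_inr] }

namespace Law

variable (L : Law.{u})

theorem hom_ext_of_add {n m k : ℕ} {f g : L.Hom (n + m) k}
    (h₁ : L.comp (L.ι (Fin.castAdd m)) f = L.comp (L.ι (Fin.castAdd m)) g)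
    (h₂ : L.comp (L.ι (Fin.natAdd n)) f = L.comp (L.ι (Fin.natAdd n)) g) : f = g :=
  (L.coproduct _ _).unique ⟨h₁, h₂⟩ ⟨rfl, rfl⟩

/-- The `a`-th coprojection `1 → n`. -/
def coproj {n : ℕ} (a : Fin n) : L.Hom 1 n := L.ι fun _ => a

theorem coproj_comp_ι {n m : ℕ} (a : Fin n) (f : Fin n → Fin m) :
    L.comp (L.coproj a) (L.ι f) = L.coproj (f a) := (L.ι_comp _ _).symm

theorem hom_ext {n k : ℕ} {f g : L.Hom n k}
    (h : ∀ a, L.comp (L.coproj a) f = L.comp (L.coproj a) g) : f = g := by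
  induction n with
  | zero => exact (L.initial k).unique trivial trivial
  | succ n ih =>
    apply L.hom_ext_of_add
    · apply ih
      intro a
      rw [← L.assoc, ← L.assoc, L.coproj_comp_ι]
      exact h _
    · have : L.ι (Fin.natAdd (m := 1) n) = L.coproj (Fin.natAdd n 0) := by
        unfold coproj
        congr 1
        funext i
        rw [Subsingleton.elim i 0]
      rw [this]
      exact h _

theorem coproj_zero : L.coproj (0 : Fin 1) = L.id 1 := by
  rw [← L.ι_id]
  unfold coproj
  congr 1
  funext i
  rw [Subsingleton.elim i 0]

theorem exists_cotuple {n k : ℕ} (f : Fin n → L.Hom 1 k) :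
    ∃ h : L.Hom n k, ∀ a, L.comp (L.coproj a) h = f a := by
  induction n with
  | zero => exact ⟨(L.initial k).choose, fun a => a.elim0⟩
  | succ n ih =>
    obtain ⟨h₁, hh₁⟩ := ih fun a => f a.castSucc
    obtain ⟨h, ⟨hl, hr⟩, -⟩ := L.coproduct h₁ (f (Fin.last n))
    refine ⟨h, fun a => ?_⟩
    refine Fin.addCases (m := n) (n := 1) (fun a => ?_) (fun a => ?_) a
    · rw [← L.coproj_comp_ι, L.assoc, hl, hh₁]
      rfl
    · rw [← L.coproj_comp_ι, L.assoc, hr, Subsingleton.elim a 0]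
      rw [L.coproj_zero, L.id_comp]
      rfl

/-- The cotuple `[f₀, …, f_{n-1}] : n → k` of maps `f_a : 1 → k`, using `n = 1 + ⋯ + 1`. -/
noncomputable def cotuple {n k : ℕ} (f : Fin n → L.Hom 1 k) : L.Hom n k :=
  (L.exists_cotuple f).choose

theorem coproj_cotuple {n k : ℕ} (f : Fin n → L.Hom 1 k) (a : Fin n) :
    L.comp (L.coproj a) (L.cotuple f) = f a := (L.exists_cotuple f).choose_spec a

theorem eq_cotuple {n k : ℕ} {f : Fin n → L.Hom 1 k} {h : L.Hom n k}
    (hh : ∀ a, L.comp (L.coproj a) h = f a) : h = L.cotuple f :=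
  L.hom_ext fun a => by rw [hh, coproj_cotuple]

theorem cotuple_comp {n k l : ℕ} (f : Fin n → L.Hom 1 k) (g : L.Hom k l) :
    L.comp (L.cotuple f) g = L.cotuple fun a => L.comp (f a) g :=
  L.eq_cotuple fun a => by rw [← L.assoc, coproj_cotuple]

theorem ι_cotuple {m n k : ℕ} (e : Fin m → Fin n) (f : Fin n → L.Hom 1 k) :
    L.comp (L.ι e) (L.cotuple f) = L.cotuple fun a => f (e a) :=
  L.eq_cotuple fun a => by rw [← L.assoc, coproj_comp_ι, coproj_cotuple]

theorem cotuple_coproj {n m : ℕ} (e : Fin n → Fin m) :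
    (L.cotuple fun a => L.coproj (e a)) = L.ι e :=
  (L.eq_cotuple fun a => L.coproj_comp_ι a e).symm

end Law

namespace LawHom

variable {L K : Law.{u}} (F : LawHom L K)

theorem map_coproj {n : ℕ} (a : Fin n) : F.map (L.coproj a) = K.coproj a := by
  obtain ⟨a, ha⟩ := a
  obtain ⟨r, rfl⟩ : ∃ r, n = (a + 1) + r := ⟨n - (a + 1), by omega⟩
  have key : ∀ M : Law.{u}, M.coproj (⟨a, ha⟩ : Fin ((a + 1) + r)) =
      M.comp (M.ι (Fin.natAdd (m := 1) a)) (M.ι (Fin.castAdd r)) := by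
    intro M
    rw [← M.ι_comp]
    unfold Law.coproj
    congr 1
    funext i
    apply Fin.ext
    simp
  rw [key, key, F.map_comp, F.map_inl, F.map_inr]

theorem map_cotuple {n k : ℕ} (f : Fin n → L.Hom 1 k) :
    F.map (L.cotuple f) = K.cotuple fun a => F.map (f a) :=
  K.eq_cotuple fun a => by rw [← F.map_coproj, ← F.map_comp, L.coproj_cotuple]

theorem map_ι {n m : ℕ} (f : Fin n → Fin m) : F.map (L.ι f) = K.ι f := by
  rw [← L.cotuple_coproj, F.map_cotuple, ← K.cotuple_coproj]
  simp only [F.map_coproj]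

end LawHom

/-! ### The monad of a Lawvere theory -/

namespace Law

variable (L : Law.{u})

/-- Elements of the coproduct `∐ᵢ L(1, i) × Xⁱ`. -/
structure Term (X : Type u) : Type u where
  arity : ℕ
  op : L.Hom 1 arity
  arg : Fin arity → X

/-- The relation `κ_m(f ∘ g, v) ∼ κ_i(g, v ∘ f)`, for functions `f : Fin i → Fin m`. -/
inductive Term.Rel {X : Type u} : L.Term X → L.Term X → Prop
  | intro {i m : ℕ} (f : Fin i → Fin m) (g : L.Hom 1 i) (v : Fin m → X) :
      Rel ⟨m, L.comp g (L.ι f), v⟩ ⟨i, g, fun a => v (f a)⟩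

/-- `T_L(X) = (∐ᵢ L(1, i) × Xⁱ) / ∼`, the quotient by the least equivalence relation that
contains `Term.Rel`. -/
def TObj (X : Type u) : Type u := Quot (Term.Rel L (X := X))

variable {L} {X Y Z : Type u}

/-- The class `[κᵢ(g, v)]`. -/
def cls {i : ℕ} (g : L.Hom 1 i) (v : Fin i → X) : L.TObj X := Quot.mk _ ⟨i, g, v⟩

theorem cls_ι {i m : ℕ} (f : Fin i → Fin m) (g : L.Hom 1 i) (v : Fin m → X) :
    cls (L.comp g (L.ι f)) v = cls g fun a => v (f a) := Quot.sound (.intro f g v)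

/-- The functorial action of `T_L`: `[κᵢ(g, v)] ↦ [κᵢ(g, h ∘ v)]`. -/
def TMap (h : X → Y) : L.TObj X → L.TObj Y :=
  Quot.lift (fun t => cls t.op fun a => h (t.arg a)) (by
    rintro _ _ ⟨f, g, v⟩
    exact cls_ι f g fun a => h (v a))

/-- The unit `x ↦ [κ₁(id₁, x)]`. -/
def TUnit (x : X) : L.TObj X := cls (L.id 1) fun _ => x

theorem cls_coproj {n : ℕ} (a : Fin n) (v : Fin n → X) :
    cls (L.coproj a) v = TUnit (L := L) (v a) := by
  have := cls_ι (L := L) (fun _ : Fin 1 => a) (L.id 1) v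
  rwa [L.id_comp] at this

/-- A representative of a class. -/
noncomputable def rep (t : L.TObj X) : L.Term X := (Quot.exists_rep t).choose

theorem cls_rep (t : L.TObj X) : cls (rep t).op (rep t).arg = t := (Quot.exists_rep t).choose_spec

/-- The value of the multiplication on `κᵢ(g, v)`. Writing `v(a) = [κ_{j_a}(g_a, v_a)]` and
`j = j₀ + ⋯ + j_{i-1}`, this is `[κ_j((g₀ + ⋯ + g_{i-1}) ∘ g, [v₀, …, v_{i-1}])]`; the map
`g₀ + ⋯ + g_{i-1} : i → j` is the cotuple of the `g_a` followed by the coprojections `j_a → j`. -/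
noncomputable def mulTerm (t : L.Term (L.TObj X)) : L.TObj X :=
  cls (i := ∑ a, (rep (t.arg a)).arity)
    (L.comp t.op (L.cotuple fun a =>
      L.comp (rep (t.arg a)).op (L.ι fun b => finSigmaFinEquiv ⟨a, b⟩)))
    (fun c => (rep (t.arg (finSigmaFinEquiv.symm c).1)).arg (finSigmaFinEquiv.symm c).2)

/-- Equality of classes, witnessed by a common refinement. -/
def Span (s t : L.Term X) : Prop :=
  ∃ (q : ℕ) (w : Fin q → X) (e : Fin s.arity → Fin q) (e' : Fin t.arity → Fin q),
    (∀ a, w (e a) = s.arg a) ∧ (∀ a, w (e' a) = t.arg a) ∧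
      L.comp s.op (L.ι e) = L.comp t.op (L.ι e')

/-- Finitely many finite families are jointly indexed by an injective one. -/
theorem exists_inj {κ : Type} [Finite κ] (n : κ → ℕ) (v : ∀ k, Fin (n k) → X) :
    ∃ (q : ℕ) (w : Fin q → X) (e : ∀ k, Fin (n k) → Fin q),
      Function.Injective w ∧ ∀ k a, w (e k a) = v k a := by
  classical
  have hfin : (Set.range fun s : Σ k, Fin (n k) => v s.1 s.2).Finite := Set.finite_range _
  obtain ⟨q, w, hw, hr⟩ := hfin.fin_param
  refine ⟨q, w, fun k a => ((hr ▸ ⟨⟨k, a⟩, rfl⟩ : v k a ∈ Set.range w)).choose, hw, fun k a => ?_⟩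
  exact ((hr ▸ ⟨⟨k, a⟩, rfl⟩ : v k a ∈ Set.range w)).choose_spec

theorem span_of_eq {s t : L.Term X} (h : (Quot.mk _ s : L.TObj X) = Quot.mk _ t) : Span s t := by
  have h' := Quot.eqvGen_exact h
  clear h
  induction h' with
  | rel s t h =>
    obtain ⟨f, g, v⟩ := h
    exact ⟨_, v, fun a => a, f, fun _ => rfl, fun _ => rfl, by rw [L.ι_id, L.comp_id]⟩
  | refl s => exact ⟨_, s.arg, fun a => a, fun a => a, fun _ => rfl, fun _ => rfl, rfl⟩
  | symm s t _ ih =>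
    obtain ⟨q, w, e, e', h₁, h₂, h₃⟩ := ih
    exact ⟨q, w, e', e, h₂, h₁, h₃.symm⟩
  | trans s t r _ _ ih₁ ih₂ =>
    obtain ⟨q, w, e, e', h₁, h₂, h₃⟩ := ih₁
    obtain ⟨q', w', d, d', k₁, k₂, k₃⟩ := ih₂
    obtain ⟨p, z, c, hz, hc⟩ := exists_inj (κ := Bool)
      (fun b => bif b then q else q') (fun b => match b with | true => w | false => w')
    have hmid : (fun a => c true (e' a)) = fun a => c false (d a) := by
      funext a
      apply hz
      rw [hc, hc]
      exact (h₂ a).trans (k₁ a).symm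
    refine ⟨p, z, fun a => c true (e a), fun a => c false (d' a), fun a => ?_, fun a => ?_, ?_⟩
    · rw [hc]; exact h₁ a
    · rw [hc]; exact k₂ a
    · rw [L.ι_comp (m := q) e (c true), L.ι_comp (m := q') d' (c false), ← L.assoc, ← L.assoc, h₃,
        ← k₃, L.assoc, L.assoc, ← L.ι_comp (m := q) e' (c true),
        ← L.ι_comp (m := q') d (c false), hmid]

/-- Substituting simultaneous representatives does not depend on their choice. -/
theorem cls_cotuple_congr {i p p' : ℕ} (g : L.Hom 1 i) (h : Fin i → L.Hom 1 p) (v : Fin p → X)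
    (h' : Fin i → L.Hom 1 p') (v' : Fin p' → X) (H : ∀ a, cls (h a) v = cls (h' a) v') :
    cls (L.comp g (L.cotuple h)) v = cls (L.comp g (L.cotuple h')) v' := by
  choose q w e e' h₁ h₂ h₃ using fun a => span_of_eq (H a)
  obtain ⟨r, z, c, hz, hc⟩ := exists_inj (κ := Option (Option (Fin i)))
    (fun k => match k with | none => p | some none => p' | some (some a) => q a)
    (fun k => match k with | none => v | some none => v' | some (some a) => w a)
  have hv : v = fun b => z (c none b) := funext fun b => (hc none b).symm
  have hv' : v' = fun b => z (c (some none) b) := funext fun b => (hc (some none) b).symm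
  have A : ∀ a, (fun b => c (some (some a)) (e a b)) = c none := fun a => by
    funext b
    apply hz
    rw [hc, hc]
    exact h₁ a b
  have B : ∀ a, (fun b => c (some (some a)) (e' a b)) = c (some none) := fun a => by
    funext b
    apply hz
    rw [hc, hc]
    exact h₂ a b
  rw [hv, hv', ← cls_ι (c none), ← cls_ι (c (some none)), L.assoc, L.assoc, L.cotuple_comp,
    L.cotuple_comp]
  congr 3
  funext a
  rw [← A a, ← B a, L.ι_comp (m := q a) (e a) (c (some (some a))),
    L.ι_comp (m := q a) (e' a) (c (some (some a))), ← L.assoc, ← L.assoc]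
  exact congrArg (fun x => L.comp x _) (h₃ a)

theorem arg_symm {i : ℕ} (r : Fin i → L.Term X) (a : Fin i) (b : Fin (r a).arity) :
    (r (finSigmaFinEquiv.symm (finSigmaFinEquiv (n := fun a => (r a).arity) ⟨a, b⟩)).1).arg
      (finSigmaFinEquiv.symm (finSigmaFinEquiv (n := fun a => (r a).arity) ⟨a, b⟩)).2 =
      (r a).arg b :=
  congrArg (fun s : Σ a, Fin (r a).arity => (r s.1).arg s.2)
    (Equiv.symm_apply_apply finSigmaFinEquiv ⟨a, b⟩)

theorem mulTerm_eq {i p : ℕ} (g : L.Hom 1 i) (t : Fin i → L.TObj X) (h : Fin i → L.Hom 1 p)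
    (v : Fin p → X) (H : ∀ a, t a = cls (h a) v) :
    mulTerm ⟨i, g, t⟩ = cls (L.comp g (L.cotuple h)) v := by
  apply cls_cotuple_congr
  intro a
  rw [← H, cls_ι]
  exact Eq.trans (congrArg (cls _) (funext fun b => arg_symm (fun a => rep (t a)) a b))
    (cls_rep (t a))

theorem exists_simul {i : ℕ} (t : Fin i → L.TObj X) :
    ∃ (p : ℕ) (h : Fin i → L.Hom 1 p) (v : Fin p → X), ∀ a, t a = cls (h a) v := by
  refine ⟨∑ a, (rep (t a)).arity,
    fun a => L.comp (rep (t a)).op (L.ι fun b => finSigmaFinEquiv ⟨a, b⟩),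
    fun c => (rep (t (finSigmaFinEquiv.symm c).1)).arg (finSigmaFinEquiv.symm c).2, fun a => ?_⟩
  rw [cls_ι]
  exact (Eq.trans (congrArg (cls _) (funext fun b => arg_symm (fun a => rep (t a)) a b))
    (cls_rep (t a))).symm

/-- The multiplication `T_L(T_L(X)) → T_L(X)`. -/
noncomputable def TMul : L.TObj (L.TObj X) → L.TObj X :=
  Quot.lift mulTerm (by
    rintro _ _ ⟨f, g, t⟩
    obtain ⟨p, h, v, H⟩ := exists_simul t
    rw [mulTerm_eq _ t h v H, mulTerm_eq g (fun a => t (f a)) (fun a => h (f a)) v fun a => H _,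
      L.assoc, L.ι_cotuple])

theorem TMul_cls {i p : ℕ} (g : L.Hom 1 i) (t : Fin i → L.TObj X) (h : Fin i → L.Hom 1 p)
    (v : Fin p → X) (H : ∀ a, t a = cls (h a) v) :
    TMul (cls g t) = cls (L.comp g (L.cotuple h)) v := mulTerm_eq g t h v H

theorem TMap_cls {i : ℕ} (f : X → Y) (g : L.Hom 1 i) (v : Fin i → X) :
    TMap f (cls g v) = cls g fun a => f (v a) := rfl

theorem cls_ind {p : L.TObj X → Prop} (h : ∀ (i : ℕ) (g : L.Hom 1 i) (v : Fin i → X), p (cls g v))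
    (t : L.TObj X) : p t := Quot.ind (fun ⟨i, g, v⟩ => h i g v) t

theorem TMul_TMap (f : X → Y) (t : L.TObj (L.TObj X)) :
    TMul (TMap (TMap f) t) = TMap f (TMul t) := by
  induction t using cls_ind with | h i g t =>
  obtain ⟨p, h, v, H⟩ := exists_simul t
  rw [TMap_cls, TMul_cls g t h v H, TMap_cls,
    TMul_cls g _ h (fun a => f (v a)) fun a => by rw [H, TMap_cls]]

theorem TMul_TMul (t : L.TObj (L.TObj (L.TObj X))) :
    TMul (TMap TMul t) = TMul (TMul t) := by
  induction t using cls_ind with | h i g t =>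
  obtain ⟨p, h, v, H⟩ := exists_simul t
  obtain ⟨q, k, w, K⟩ := exists_simul v
  rw [TMap_cls, TMul_cls g t h v H, TMul_cls _ v k w K,
    TMul_cls g _ (fun a => L.comp (h a) (L.cotuple k)) w fun a => by rw [H, TMul_cls _ v k w K],
    L.assoc, L.cotuple_comp]

theorem TMul_TUnit (t : L.TObj X) : TMul (TUnit t) = t := by
  induction t using cls_ind with | h i g t =>
  rw [TUnit, TMul_cls (L.id 1) _ (fun _ => g) t fun _ => rfl, L.id_comp, ← L.eq_cotuple]
  intro a
  rw [Subsingleton.elim a 0, L.coproj_zero, L.id_comp]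

theorem TMul_TMap_TUnit (t : L.TObj X) : TMul (TMap TUnit t) = t := by
  induction t using cls_ind with | h i g t =>
  rw [TMap_cls, TMul_cls g _ L.coproj t fun a => (cls_coproj a t).symm,
    L.cotuple_coproj fun a => a, L.ι_id, L.comp_id]

variable (L) in
/-- The monad `T_L` on the category of sets. -/
noncomputable def toMonad : Monad (Type u) where
  obj X := L.TObj X
  map f := ↾(TMap f)
  map_id X := by
    ext t
    induction t using cls_ind with | h i g t => rfl
  map_comp f g := by
    ext t
    induction t using cls_ind with | h i g t => rfl
  η := { app := fun X => ↾TUnit, naturality := fun X Y f => by ext x; rfl }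
  μ := { app := fun X => ↾TMul, naturality := fun X Y f => by ext t; exact TMul_TMap f t }
  assoc X := by ext t; exact TMul_TMul t
  left_unit X := by ext t; exact TMul_TUnit t
  right_unit X := by ext t; exact TMul_TMap_TUnit t

end Law

namespace LawHom

variable {L K : Law.{u}} (F : LawHom L K) {X : Type u}

/-- The components `[κᵢ(g, v)] ↦ [κᵢ(F(g), v)]` of `𝒯(F)`. -/
def TApp : L.TObj X → K.TObj X :=
  Quot.lift (fun t => Law.cls (F.map t.op) t.arg) (by
    rintro _ _ ⟨f, g, v⟩
    rw [F.map_comp, F.map_ι]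
    exact Law.cls_ι f _ v)

theorem TApp_cls {i : ℕ} (g : L.Hom 1 i) (v : Fin i → X) :
    F.TApp (Law.cls g v) = Law.cls (F.map g) v := rfl

theorem TApp_TMul (t : L.TObj (L.TObj X)) :
    F.TApp (Law.TMul t) = Law.TMul (F.TApp (Law.TMap F.TApp t)) := by
  induction t using Law.cls_ind with | h i g t =>
  obtain ⟨p, h, v, H⟩ := Law.exists_simul t
  rw [Law.TMul_cls g t h v H, Law.TMap_cls, TApp_cls, TApp_cls,
    Law.TMul_cls _ _ (fun a => F.map (h a)) v (fun a => by rw [H, TApp_cls]),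
    F.map_comp, F.map_cotuple]

end LawHom

/-- The functor `𝒯 : Law ⥤ Mnd` sending a Lawvere theory to its monad. -/
noncomputable def lawToMonad : Law.{u} ⥤ Monad (Type u) where
  obj L := L.toMonad
  map {L K} F :=
    { app := fun X => ↾(LawHom.TApp F)
      naturality := fun X Y f => by
        ext t
        induction t using Law.cls_ind with | h i g t => rfl
      app_η := fun X => by
        ext x
        exact congrArg (fun g => Law.cls g fun _ => x) (LawHom.map_id F 1)
      app_μ := fun X => by
        ext t
        exact LawHom.TApp_TMul F t }
  map_id L := by
    ext X t
    induction t using Law.cls_ind with | h i g t => rfl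
  map_comp F G := by
    ext X t
    induction t using Law.cls_ind with | h i g t => rfl

/-! ### Symmetric monoidal Lawvere theories -/

/-- The coordinatisation `co(c) = (a, b)` iff `c = a * m + b`. -/
def co {n m : ℕ} : Fin (n * m) ≃ Fin n × Fin m := finProdFinEquiv.symm

theorem co_eq_iff {n m : ℕ} (c : Fin (n * m)) (a : Fin n) (b : Fin m) :
    co c = (a, b) ↔ (c : ℕ) = a * m + b := by
  rw [co, Equiv.symm_apply_eq, Fin.ext_iff, finProdFinEquiv_apply_val, Nat.add_comm,
    Nat.mul_comm m]

/-- The symmetric monoidal structure of the category of the finite sets `{0, …, n-1}`, with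
`n ⊗ m = n * m` and unit `1`: tensor of functions. -/
def finTensor {n m p q : ℕ} (f : Fin n → Fin p) (g : Fin m → Fin q) (c : Fin (n * m)) :
    Fin (p * q) := co.symm (f (co c).1, g (co c).2)

/-- The associativity isomorphism `a ⊗ (b ⊗ c) ↦ (a ⊗ b) ⊗ c`. -/
def finAssoc (n m k : ℕ) (c : Fin (n * (m * k))) : Fin ((n * m) * k) :=
  co.symm (co.symm ((co c).1, (co (co c).2).1), (co (co c).2).2)

/-- The left unit isomorphism. -/
def finLeft (n : ℕ) (c : Fin (1 * n)) : Fin n := (co c).2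

/-- The right unit isomorphism. -/
def finRight (n : ℕ) (c : Fin (n * 1)) : Fin n := (co c).1

/-- The swap `a ⊗ b ↦ b ⊗ a`. -/
def finSwap (n m : ℕ) (c : Fin (n * m)) : Fin (m * n) := co.symm ((co c).2, (co c).1)

/-- A symmetric monoidal Lawvere theory: the functor `ι` strictly preserves the symmetric monoidal
structure. So on objects the tensor is multiplication with unit `1`, and the associativity, unit
and swap isomorphisms are the images under `ι` of those for finite sets; what has to be given is
the bifunctor on morphisms, extending the one on functions, for which these isomorphisms are
natural. The coherence equations then hold automatically, as the instance
`SymmetricCategory L.Ob` below shows. -/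
structure SMLaw : Type (u + 1) extends Law.{u} where
  tensor : ∀ {n m p q}, Hom n p → Hom m q → Hom (n * m) (p * q)
  tensor_id : ∀ n m, tensor (id n) (id m) = id (n * m)
  tensor_comp : ∀ {n p r m q s} (f : Hom n p) (f' : Hom p r) (g : Hom m q) (g' : Hom q s),
    tensor (comp f f') (comp g g') = comp (tensor f g) (tensor f' g')
  tensor_ι : ∀ {n m p q} (f : Fin n → Fin p) (g : Fin m → Fin q),
    tensor (ι f) (ι g) = ι (finTensor f g)
  assoc_natural : ∀ {n p m q k r} (f : Hom n p) (g : Hom m q) (h : Hom k r),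
    comp (tensor f (tensor g h)) (ι (finAssoc p q r)) =
      comp (ι (finAssoc n m k)) (tensor (tensor f g) h)
  left_natural : ∀ {n p} (f : Hom n p),
    comp (tensor (id 1) f) (ι (finLeft p)) = comp (ι (finLeft n)) f
  right_natural : ∀ {n p} (f : Hom n p),
    comp (tensor f (id 1)) (ι (finRight p)) = comp (ι (finRight n)) f
  swap_natural : ∀ {n p m q} (f : Hom n p) (g : Hom m q),
    comp (tensor f g) (ι (finSwap p q)) = comp (ι (finSwap n m)) (tensor g f)

namespace SMLaw

variable (L : SMLaw.{u})

/-! A symmetric monoidal Lawvere theory is a symmetric monoidal category. -/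

/-- The objects of the category `L`. -/
structure Ob (_L : SMLaw.{u}) where
  n : ℕ

instance : Category (L.Ob) where
  Hom a b := L.Hom a.n b.n
  id a := L.id a.n
  comp f g := L.comp f g
  id_comp := L.id_comp
  comp_id := L.comp_id
  assoc := L.assoc

/-- The image under `ι` of a bijection. -/
def ιIso {a b : ℕ} (f : Fin a → Fin b) (g : Fin b → Fin a) (h : ∀ i, g (f i) = i) (h' : ∀ i, f (g i) = i) : (Ob.mk a : L.Ob) ≅ Ob.mk b where
  hom := L.ι f
  inv := L.ι g
  hom_inv_id := by change L.comp _ _ = L.id _; rw [← L.ι_comp, ← L.ι_id]; simp [h]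
  inv_hom_id := by change L.comp _ _ = L.id _; rw [← L.ι_comp, ← L.ι_id]; simp [h']

theorem id_tensor_ι {n p q} (f : Fin p → Fin q) : L.tensor (L.id n) (L.ι f) = L.ι (finTensor id f) := by
  rw [← L.ι_id, L.tensor_ι]; rfl
theorem ι_tensor_id {n p q} (f : Fin p → Fin q) : L.tensor (L.ι f) (L.id n) = L.ι (finTensor f id) := by
  rw [← L.ι_id, L.tensor_ι]; rfl

instance : MonoidalCategoryStruct (L.Ob) where
  tensorObj a b := ⟨a.n * b.n⟩
  tensorHom f g := L.tensor f g
  whiskerLeft a _ _ f := L.tensor (L.id a.n) f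
  whiskerRight f b := L.tensor f (L.id b.n)
  tensorUnit := ⟨1⟩
  associator a b c := (L.ιIso (finAssoc a.n b.n c.n) (fun i => co.symm ((co (co i).1).1, co.symm ((co (co i).1).2, (co i).2)))
     (by simp [finAssoc]) (by simp [finAssoc])).symm
  leftUnitor a := L.ιIso (finLeft a.n) (fun i => co.symm (0, i)) (by intro i; apply co.injective; ext <;> simp [finLeft]) (by simp [finLeft])
  rightUnitor a := L.ιIso (finRight a.n) (fun i => co.symm (i, 0)) (by intro i; apply co.injective; ext <;> simp [finRight]) (by simp [finRight])


instance : MonoidalCategory (L.Ob) where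
  tensorHom_def {a b c d} f g := by
    change L.tensor f g = L.comp (L.tensor f (L.id c.n)) (L.tensor (L.id b.n) g)
    rw [← L.tensor_comp, L.id_comp, L.comp_id]
  id_tensorHom_id a b := L.tensor_id _ _
  tensorHom_comp_tensorHom f g f' g' := (L.tensor_comp _ _ _ _).symm
  whiskerLeft_id a b := L.tensor_id _ _
  id_whiskerRight a b := L.tensor_id _ _
  associator_naturality f g h := by
    rw [← Iso.inv_comp_eq, ← Category.assoc, ← Iso.eq_comp_inv]
    exact (L.assoc_natural f g h).symm
  leftUnitor_naturality f := L.left_natural f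
  rightUnitor_naturality f := L.right_natural f
  pentagon a b c d := by
    change L.comp (L.tensor (L.ι _) (L.id _)) (L.comp (L.ι _) (L.tensor (L.id _) (L.ι _))) = L.comp (L.ι _) (L.ι _)
    rw [L.id_tensor_ι, L.ι_tensor_id, ← L.ι_comp, ← L.ι_comp, ← L.ι_comp]
    congr 1
    funext i
    simp [finTensor]
  triangle a b := by
    change L.comp (L.ι _) (L.tensor (L.id _) (L.ι _)) = L.tensor (L.ι _) (L.id _)
    rw [L.id_tensor_ι, L.ι_tensor_id, ← L.ι_comp]
    congr 1
    funext i
    simp [finTensor, finLeft, finRight]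

instance : SymmetricCategory (L.Ob) where
  braiding a b := L.ιIso (finSwap a.n b.n) (finSwap b.n a.n) (by simp [finSwap]) (by simp [finSwap])
  braiding_naturality_right X _ _ f := L.swap_natural (L.id X.n) f
  braiding_naturality_left f X := L.swap_natural f (L.id X.n)
  hexagon_forward a b c := by
    change L.comp (L.ι _) (L.comp (L.ι _) (L.ι _)) = L.comp (L.tensor (L.ι _) (L.id _)) (L.comp (L.ι _) (L.tensor (L.id _) (L.ι _)))
    rw [L.id_tensor_ι, L.ι_tensor_id]; simp only [← L.ι_comp]
    congr 1
    funext i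
    simp [finTensor, finSwap]
  hexagon_reverse a b c := by
    change L.comp (L.ι _) (L.comp (L.ι _) (L.ι _)) = L.comp (L.tensor (L.id _) (L.ι _)) (L.comp (L.ι _) (L.tensor (L.ι _) (L.id _)))
    rw [L.id_tensor_ι, L.ι_tensor_id]; simp only [← L.ι_comp]
    congr 1
    funext i
    simp [finTensor, finSwap, finAssoc]
  symmetry a b := (L.ιIso (finSwap a.n b.n) (finSwap b.n a.n) (by simp [finSwap]) (by simp [finSwap])).hom_inv_id

end SMLaw

/-- A morphism of symmetric monoidal Lawvere theories: one of Lawvere theories that strictly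
preserves the tensor. -/
@[ext]
structure SMLawHom (L K : SMLaw.{u}) : Type u extends LawHom L.toLaw K.toLaw where
  map_tensor : ∀ {n m p q} (f : L.Hom n p) (g : L.Hom m q),
    map (L.tensor f g) = K.tensor (map f) (map g)

instance : Category SMLaw.{u} where
  Hom := SMLawHom
  id L := { toLawHom := 𝟙 L.toLaw, map_tensor := fun _ _ => rfl }
  comp F G :=
    { toLawHom := CategoryStruct.comp (obj := Law.{u}) F.toLawHom G.toLawHom
      map_tensor := fun f g =>
        (congrArg G.map (F.map_tensor f g)).trans (G.map_tensor _ _) }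
  id_comp _ := rfl
  comp_id _ := rfl
  assoc _ _ _ := rfl

/-- The forgetful functor `SMLaw ⥤ Law`. -/
def smLawToLaw : SMLaw.{u} ⥤ Law.{u} where
  obj L := L.toLaw
  map F := F.toLawHom

/-! ### Biproducts -/

namespace Law

variable (L : Law.{u})

/-- The maps that factor through the object `0`. -/
def IsZero {n m : ℕ} (f : L.Hom n m) : Prop :=
  ∃ (a : L.Hom n 0) (b : L.Hom 0 m), f = L.comp a b

/-- `π₁ = [id, 0] : n + m → n` and `π₂ = [0, id] : n + m → m`. -/
structure IsProjections {n m : ℕ} (π₁ : L.Hom (n + m) n) (π₂ : L.Hom (n + m) m) : Prop where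
  inl_fst : L.comp (L.ι (Fin.castAdd m)) π₁ = L.id n
  inr_fst : L.IsZero (L.comp (L.ι (Fin.natAdd n)) π₁)
  inl_snd : L.IsZero (L.comp (L.ι (Fin.castAdd m)) π₂)
  inr_snd : L.comp (L.ι (Fin.natAdd n)) π₂ = L.id m

/-- `(+, 0)` form biproducts: `0` is also terminal, and the coproduct `n + m` is also a product,
via projections that satisfy the biproduct equations. -/
structure HasBiproducts : Prop where
  terminal : ∀ n, ∃! _f : L.Hom n 0, True
  biproduct : ∀ n m, ∃ (π₁ : L.Hom (n + m) n) (π₂ : L.Hom (n + m) m), L.IsProjections π₁ π₂ ∧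
    ∀ {k} (f : L.Hom k n) (g : L.Hom k m), ∃! h : L.Hom k (n + m),
      L.comp h π₁ = f ∧ L.comp h π₂ = g

end Law

/-- The projections of the biproducts are strictly preserved by all morphisms of Lawvere
theories (when `0` is terminal, `IsProjections` determines its arguments). -/
theorem LawHom.map_isProjections {L K : Law.{u}} (F : LawHom L K) {n m : ℕ}
    {π₁ : L.Hom (n + m) n} {π₂ : L.Hom (n + m) m} (h : L.IsProjections π₁ π₂) :
    K.IsProjections (F.map π₁) (F.map π₂) where
  inl_fst := by rw [← F.map_ι, ← F.map_comp, h.inl_fst, F.map_id]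
  inr_fst := by
    obtain ⟨a, b, hab⟩ := h.inr_fst
    exact ⟨F.map a, F.map b, by rw [← F.map_ι, ← F.map_comp, hab, F.map_comp]⟩
  inl_snd := by
    obtain ⟨a, b, hab⟩ := h.inl_snd
    exact ⟨F.map a, F.map b, by rw [← F.map_ι, ← F.map_comp, hab, F.map_comp]⟩
  inr_snd := by rw [← F.map_ι, ← F.map_comp, h.inr_snd, F.map_id]

theorem Law.IsProjections.unique {L : Law.{u}} (h0 : ∀ n, ∃! _f : L.Hom n 0, True) {n m : ℕ}
    {π₁ π₁' : L.Hom (n + m) n} {π₂ π₂' : L.Hom (n + m) m} (h : L.IsProjections π₁ π₂)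
    (h' : L.IsProjections π₁' π₂') : π₁ = π₁' ∧ π₂ = π₂' := by
  have hz : ∀ {k l} {f g : L.Hom k l}, L.IsZero f → L.IsZero g → f = g := by
    rintro k l _ _ ⟨a, b, rfl⟩ ⟨a', b', rfl⟩
    rw [(h0 k).unique (y₁ := a) (y₂ := a') trivial trivial,
      (L.initial l).unique (y₁ := b) (y₂ := b') trivial trivial]
  exact ⟨L.hom_ext_of_add (h.inl_fst.trans h'.inl_fst.symm) (hz h.inr_fst h'.inr_fst),
    L.hom_ext_of_add (hz h.inl_snd h'.inl_snd) (h.inr_snd.trans h'.inr_snd.symm)⟩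

/-- The symmetric monoidal Lawvere theories in which `(+, 0)` form biproducts. -/
def SMLaw.biproductProperty : ObjectProperty SMLaw.{u} := fun L => L.toLaw.HasBiproducts

/-- The category of symmetric monoidal Lawvere theories with biproducts. -/
abbrev SMBLaw : Type (u + 1) := SMLaw.biproductProperty.{u}.FullSubcategory

/-! ### Additive commutative monads on sets -/

namespace SetMonad

variable (T : Monad (Type u)) {X Y Z W : Type u}

/-- The strength `T(X) × Y → T(X × Y)`. -/
def st (p : T.obj X × Y) : T.obj (X × Y) := T.map (↾fun x => (x, p.2)) p.1

/-- The swapped strength `st' = T(γ) ∘ st ∘ γ : X × T(Y) → T(X × Y)`. -/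
def st' (p : X × T.obj Y) : T.obj (X × Y) := T.map (↾Prod.swap) (st T p.swap)

/-- The map `μ ∘ T(st') ∘ st : T(X) × T(Y) → T(X × Y)`. -/
def dst (p : T.obj X × T.obj Y) : T.obj (X × Y) := T.μ.app _ (T.map (↾(st' T)) (st T p))

/-- The map `μ ∘ T(st) ∘ st' : T(X) × T(Y) → T(X × Y)`. -/
def dst' (p : T.obj X × T.obj Y) : T.obj (X × Y) := T.μ.app _ (T.map (↾(st T)) (st' T p))

/-- Commutative monads. -/
def IsCommutative : Prop :=
  ∀ (X Y : Type u) (p : T.obj X × T.obj Y), dst T p = dst' T p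

variable {T} in
/-- The zero map `X → 1 ≅ T(0) → T(Y)`, for final `T(0)`. -/
noncomputable def zero (h : Nonempty (Unique (T.obj PEmpty.{u + 1}))) (_x : X) : T.obj Y :=
  T.map (↾PEmpty.elim) (Classical.choice h).default

variable {T} in
/-- `p₁ = [η, 0] : X + Y → T(X)`. -/
noncomputable def p₁ (h : Nonempty (Unique (T.obj PEmpty.{u + 1}))) : X ⊕ Y → T.obj X :=
  Sum.elim (T.η.app X) (zero h)

variable {T} in
/-- `p₂ = [0, η] : X + Y → T(Y)`. -/
noncomputable def p₂ (h : Nonempty (Unique (T.obj PEmpty.{u + 1}))) : X ⊕ Y → T.obj Y :=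
  Sum.elim (zero h) (T.η.app Y)

variable {T} in
/-- The map `bc = ⟨μ ∘ T(p₁), μ ∘ T(p₂)⟩ : T(X + Y) → T(X) × T(Y)`. -/
noncomputable def bc (h : Nonempty (Unique (T.obj PEmpty.{u + 1}))) (t : T.obj (X ⊕ Y)) : T.obj X × T.obj Y :=
  (T.μ.app X (T.map (↾(p₁ h)) t), T.μ.app Y (T.map (↾(p₂ h)) t))

/-- Additive monads: `T(0) ≅ 1` and `bc` is an isomorphism. -/
def IsAdditive : Prop :=
  ∃ h : Nonempty (Unique (T.obj PEmpty.{u + 1})),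
    ∀ X Y : Type u, Function.Bijective (bc h (X := X) (Y := Y))

end SetMonad

/-- The monads on sets that are additive and commutative. -/
def acMonadProperty : ObjectProperty (Monad (Type u)) :=
  fun T => SetMonad.IsAdditive T ∧ SetMonad.IsCommutative T

/-- The category of additive commutative monads on sets, with monad morphisms. -/
abbrev ACMnd : Type (u + 1) := acMonadProperty.{u}.FullSubcategory

/-! ### The finitary Kleisli construction -/

namespace SetMonad

variable (T : Monad (Type u)) {X Y Z W : Type u}

/-- Kleisli extension. -/
def bind (t : T.obj X) (k : X → T.obj Y) : T.obj Y := T.μ.app Y (T.map (↾k) t)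

/-- The unit. -/
def pure (x : X) : T.obj X := T.η.app X x

theorem map_map (f : X → Y) (g : Y → Z) (t : T.obj X) :
    T.map (↾g) (T.map (↾f) t) = T.map (↾fun x => g (f x)) t :=
  (ConcreteCategory.congr_hom (T.map_comp (↾f) (↾g)) t).symm

theorem map_pure (f : X → Y) (x : X) : T.map (↾f) (pure T x) = pure T (f x) :=
  (ConcreteCategory.congr_hom (T.η.naturality (↾f)) x).symm

theorem pure_bind (x : X) (k : X → T.obj Y) : bind T (pure T x) k = k x := by
  unfold bind
  rw [map_pure]
  exact ConcreteCategory.congr_hom (T.left_unit Y) (k x)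

theorem bind_pure (t : T.obj X) : bind T t (pure T) = t :=
  ConcreteCategory.congr_hom (T.right_unit X) t

theorem map_bind (f : Y → Z) (t : T.obj X) (k : X → T.obj Y) :
    T.map (↾f) (bind T t k) = bind T t fun x => T.map (↾f) (k x) := by
  unfold bind
  have := ConcreteCategory.congr_hom (T.μ.naturality (↾f)) (T.map (↾k) t)
  exact this.symm.trans (congrArg (T.μ.app Z) (map_map T k (T.map (↾f)) t))

theorem bind_map (f : X → Y) (t : T.obj X) (k : Y → T.obj Z) :
    bind T (T.map (↾f) t) k = bind T t fun x => k (f x) := by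
  unfold bind
  rw [map_map]

theorem bind_assoc (t : T.obj X) (k : X → T.obj Y) (l : Y → T.obj Z) :
    bind T (bind T t k) l = bind T t fun x => bind T (k x) l := by
  conv_lhs => unfold bind
  have h : T.map (↾l) (T.μ.app Y (T.map (↾k) t)) = bind T t fun x => T.map (↾l) (k x) :=
    map_bind T l t k
  rw [h]
  unfold bind
  have := ConcreteCategory.congr_hom (T.assoc Z) (T.map (↾fun x => T.map (↾l) (k x)) t)
  exact this.symm.trans (congrArg (T.μ.app Z) (map_map T _ (T.μ.app Z) t))

theorem map_eq_bind (f : X → Y) (t : T.obj X) :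
    T.map (↾f) t = bind T t fun x => pure T (f x) := by
  rw [← bind_map T f t (pure T), bind_pure]

theorem dst_eq (s : T.obj X) (t : T.obj Y) :
    dst T (s, t) = bind T s fun x => bind T t fun y => pure T (x, y) := by
  change bind T (st T (s, t)) (st' T) = _
  unfold st
  rw [bind_map]
  congr 1
  funext x
  unfold st' st
  rw [map_map, map_eq_bind]
  rfl

theorem dst'_eq (s : T.obj X) (t : T.obj Y) :
    dst' T (s, t) = bind T t fun y => bind T s fun x => pure T (x, y) := by
  change bind T (st' T (s, t)) (st T) = _
  unfold st' st
  rw [map_map, bind_map]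
  congr 1
  funext y
  rw [map_eq_bind]
  rfl

variable {T} in
theorem IsCommutative.bind_swap (hT : IsCommutative T) (s : T.obj X) (t : T.obj Y)
    (k : X → Y → T.obj Z) :
    (bind T s fun x => bind T t fun y => k x y) = bind T t fun y => bind T s fun x => k x y := by
  have h := congrArg (fun d => bind T d fun p => k p.1 p.2) (hT X Y (s, t))
  simpa only [dst_eq, dst'_eq, bind_assoc, pure_bind] using h

/-- The finite set `{0, …, n-1}`. -/
abbrev Ord (n : ℕ) : Type u := ULift.{u} (Fin n)

/-- The finitary Kleisli category of `T`: a map `n → m` is a function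
`{0, …, n-1} → T({0, …, m-1})`, with Kleisli composition. -/
def klLaw : Law.{u} where
  Hom n m := Fin n → T.obj (Ord m)
  id n i := pure T ⟨i⟩
  comp f g i := bind T (f i) fun j => g j.down
  id_comp f := by funext i; exact pure_bind T _ _
  comp_id f := by funext i; exact bind_pure T _
  assoc f g h := by funext i; exact bind_assoc T _ _ _
  ι f i := pure T ⟨f i⟩
  ι_id n := rfl
  ι_comp {n m k} f g := by
    funext i
    exact (pure_bind T (⟨f i⟩ : Ord m) fun j => pure T (⟨g j.down⟩ : Ord k)).symm
  initial m := ⟨fun i => i.elim0, trivial, fun f _ => funext fun i => i.elim0⟩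
  coproduct {n m k} f g := by
    refine ⟨Fin.addCases f g, ⟨?_, ?_⟩, ?_⟩
    · funext i
      rw [pure_bind]
      exact Fin.addCases_left i
    · funext i
      rw [pure_bind]
      exact Fin.addCases_right i
    · rintro h ⟨rfl, rfl⟩
      funext i
      refine Fin.addCases (fun i => ?_) (fun i => ?_) i
      · rw [Fin.addCases_left, pure_bind]
      · rw [Fin.addCases_right, pure_bind]

/-- The tensor `T(co⁻¹) ∘ dst ∘ (f × g) ∘ co` of maps in the finitary Kleisli category. -/
def klTensor {n m p q : ℕ} (f : Fin n → T.obj (Ord.{u} p)) (g : Fin m → T.obj (Ord.{u} q))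
    (c : Fin (n * m)) : T.obj (Ord.{u} (p * q)) :=
  T.map (↾fun z : Ord.{u} p × Ord.{u} q => ULift.up (co.symm (z.1.down, z.2.down)))
    (dst T (f (co c).1, g (co c).2))

theorem klTensor_eq {n m p q : ℕ} (f : Fin n → T.obj (Ord.{u} p)) (g : Fin m → T.obj (Ord.{u} q))
    (c : Fin (n * m)) :
    klTensor T f g c = bind T (f (co c).1) fun x => bind T (g (co c).2) fun y =>
      pure T ⟨co.symm (x.down, y.down)⟩ := by
  unfold klTensor
  rw [dst_eq]
  simp only [map_eq_bind, bind_assoc, pure_bind]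

section Tensor

variable {n m k p q r s a b c : ℕ} (f : Fin n → T.obj (Ord.{u} p)) (g : Fin m → T.obj (Ord.{u} q))
  (h : Fin k → T.obj (Ord.{u} r))

theorem klTensor_assoc (i : Fin (n * (m * k))) :
    (bind T (klTensor T f (klTensor T g h) i) fun j =>
      pure T (⟨finAssoc p q r j.down⟩ : Ord.{u} (p * q * r))) =
      klTensor T (klTensor T f g) h (finAssoc n m k i) := by
  simp only [klTensor_eq, pure_bind, bind_assoc, finAssoc, Equiv.apply_symm_apply]

theorem klTensor_left (i : Fin (1 * n)) :
    (bind T (klTensor T (fun i : Fin 1 => pure T (⟨i⟩ : Ord.{u} 1)) f i) fun j =>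
      pure T (⟨finLeft p j.down⟩ : Ord.{u} p)) = f (finLeft n i) := by
  simp only [klTensor_eq, pure_bind, bind_assoc, finLeft, Equiv.apply_symm_apply]
  exact bind_pure T _

theorem klTensor_right (i : Fin (n * 1)) :
    (bind T (klTensor T f (fun i : Fin 1 => pure T (⟨i⟩ : Ord.{u} 1)) i) fun j =>
      pure T (⟨finRight p j.down⟩ : Ord.{u} p)) = f (finRight n i) := by
  simp only [klTensor_eq, pure_bind, bind_assoc, finRight, Equiv.apply_symm_apply]
  exact bind_pure T _

variable {T} in
theorem klTensor_swap (hT : IsCommutative T) (i : Fin (n * m)) :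
    (bind T (klTensor T f g i) fun j => pure T (⟨finSwap p q j.down⟩ : Ord.{u} (q * p))) =
      klTensor T g f (finSwap n m i) := by
  simp only [klTensor_eq, pure_bind, bind_assoc, finSwap, Equiv.apply_symm_apply]
  exact hT.bind_swap _ _ _

variable {T} in
theorem klTensor_comp (hT : IsCommutative T) (f' : Fin p → T.obj (Ord.{u} a))
    (g' : Fin q → T.obj (Ord.{u} b)) (i : Fin (n * m)) :
    klTensor T (fun i => bind T (f i) fun j => f' j.down)
      (fun i => bind T (g i) fun j => g' j.down) i =
      bind T (klTensor T f g i) fun j => klTensor T f' g' j.down := by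
  simp only [klTensor_eq, pure_bind, bind_assoc, Equiv.apply_symm_apply]
  refine congrArg (bind T (f (co i).1)) (funext fun x => ?_)
  exact hT.bind_swap _ _ _

theorem klTensor_pure (f : Fin n → Fin p) (g : Fin m → Fin q) (i : Fin (n * m)) :
    klTensor T (fun i => pure T (⟨f i⟩ : Ord.{u} p)) (fun i => pure T (⟨g i⟩ : Ord.{u} q)) i =
      pure T (⟨finTensor f g i⟩ : Ord.{u} (p * q)) := by
  simp only [klTensor_eq, pure_bind, finTensor]

end Tensor

variable {T} in
/-- For commutative `T` the finitary Kleisli category is a symmetric monoidal Lawvere theory. -/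
def klSMLaw (hT : IsCommutative T) : SMLaw.{u} where
  toLaw := klLaw T
  tensor f g := klTensor T f g
  tensor_id _ _ := funext fun c => (klTensor_pure T (fun i => i) (fun i => i) c).trans
    (congrArg (fun i => pure T (ULift.up i)) (co.symm_apply_apply c))
  tensor_comp f f' g g' := funext fun c => klTensor_comp f g hT f' g' c
  tensor_ι f g := funext fun c => klTensor_pure T f g c
  assoc_natural {n _ m _ k _} f g h := funext fun c => (klTensor_assoc T f g h c).trans
    (pure_bind T (⟨finAssoc n m k c⟩ : Ord.{u} (n * m * k)) fun j =>
      klTensor T (klTensor T f g) h j.down).symm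
  left_natural {n _} f := funext fun c => (klTensor_left T f c).trans
    (pure_bind T (⟨finLeft n c⟩ : Ord.{u} n) fun j => f j.down).symm
  right_natural {n _} f := funext fun c => (klTensor_right T f c).trans
    (pure_bind T (⟨finRight n c⟩ : Ord.{u} n) fun j => f j.down).symm
  swap_natural {n _ m _} f g := funext fun c => (klTensor_swap f g hT c).trans
    (pure_bind T (⟨finSwap n m c⟩ : Ord.{u} (m * n)) fun j => klTensor T g f j.down).symm

theorem exists_eq_of_final (h : Nonempty (Unique (T.obj PEmpty.{u + 1}))) :
    ∃ z : T.obj (Ord.{u} 0), ∀ y, y = z := by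
  have key : ∀ y : T.obj (Ord.{u} 0), T.map (↾fun e : PEmpty.{u + 1} => e.elim)
      (T.map (↾fun e : Ord.{u} 0 => (e.down.elim0 : PEmpty.{u + 1})) y) = y := fun y => by
    rw [map_map, map_eq_bind]
    conv_rhs => rw [← bind_pure T y]
    congr 1
    funext e
    exact e.down.elim0
  refine ⟨T.map (↾fun e : PEmpty.{u + 1} => e.elim) (Classical.choice h).default, fun y => ?_⟩
  rw [← key y]
  exact congrArg _ ((Classical.choice h).uniq _)

variable {T} in
theorem isZero_zero (h : Nonempty (Unique (T.obj PEmpty.{u + 1}))) {n m : ℕ} :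
    (klLaw T).IsZero (n := n) (m := m) (fun _ => zero h PUnit.unit.{u + 1}) := by
  refine ⟨fun _ => zero h PUnit.unit.{u + 1}, fun i => i.elim0, ?_⟩
  funext i
  change _ = bind T (T.map _ _) _
  rw [bind_map]
  unfold zero
  rw [map_eq_bind]
  congr 1
  funext e
  exact e.elim

variable {T} in
/-- For additive `T` the finitary Kleisli category has biproducts. -/
theorem klLaw_hasBiproducts (hT : IsAdditive T) : (klLaw T).HasBiproducts := by
  obtain ⟨h, hbc⟩ := hT
  refine ⟨fun n => ?_, fun n m => ?_⟩
  · obtain ⟨z, hz⟩ := exists_eq_of_final T h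
    exact ⟨fun _ => z, trivial, fun f _ => funext fun i => hz (f i)⟩
  · let e' : Ord.{u} n ⊕ Ord.{u} m → Ord.{u} (n + m) :=
      Sum.elim (fun i => ⟨Fin.castAdd m i.down⟩) (fun i => ⟨Fin.natAdd n i.down⟩)
    let e : Ord.{u} (n + m) → Ord.{u} n ⊕ Ord.{u} m := fun c =>
      Fin.addCases (fun i => Sum.inl ⟨i⟩) (fun i => Sum.inr ⟨i⟩) c.down
    have he : ∀ c, e' (e c) = c := by
      rintro ⟨c⟩
      refine Fin.addCases (fun i => ?_) (fun i => ?_) c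
      · simp only [e, e', Fin.addCases_left, Sum.elim_inl]
      · simp only [e, e', Fin.addCases_right, Sum.elim_inr]
    let π₁ : Fin (n + m) → T.obj (Ord.{u} n) :=
      Fin.addCases (fun i => pure T ⟨i⟩) (fun _ => zero h PUnit.unit.{u + 1})
    let π₂ : Fin (n + m) → T.obj (Ord.{u} m) :=
      Fin.addCases (fun _ => zero h PUnit.unit.{u + 1}) (fun i => pure T ⟨i⟩)
    have hp₁ : ∀ x, π₁ (e' x).down = p₁ h x := by
      rintro (x | x)
      · exact Fin.addCases_left x.down
      · exact Fin.addCases_right x.down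
    have hp₂ : ∀ x, π₂ (e' x).down = p₂ h x := by
      rintro (x | x)
      · exact Fin.addCases_left x.down
      · exact Fin.addCases_right x.down
    have h₁ : ∀ t, bind T (T.map (↾e') t) (fun j => π₁ j.down) = (bc h t).1 := fun t => by
      rw [bind_map]
      simp only [hp₁]
      rfl
    have h₂ : ∀ t, bind T (T.map (↾e') t) (fun j => π₂ j.down) = (bc h t).2 := fun t => by
      rw [bind_map]
      simp only [hp₂]
      rfl
    have hee : ∀ s, T.map (↾e') (T.map (↾e) s) = s := fun s => by
      rw [map_map, map_eq_bind]
      simp only [he]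
      exact bind_pure T s
    refine ⟨π₁, π₂, ⟨?_, ?_, ?_, ?_⟩, fun {k} f g => ?_⟩
    · funext i
      exact (pure_bind T _ _).trans (Fin.addCases_left i)
    · have hz : (klLaw T).comp ((klLaw T).ι (Fin.natAdd n)) π₁ =
          fun _ => zero h PUnit.unit.{u + 1} :=
        funext fun i => (pure_bind T _ _).trans (Fin.addCases_right i)
      rw [hz]
      exact isZero_zero h
    · have hz : (klLaw T).comp ((klLaw T).ι (Fin.castAdd m)) π₂ =
          fun _ => zero h PUnit.unit.{u + 1} :=
        funext fun i => (pure_bind T _ _).trans (Fin.addCases_left i)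
      rw [hz]
      exact isZero_zero h
    · funext i
      exact (pure_bind T _ _).trans (Fin.addCases_right i)
    · choose t ht using fun i => (hbc (Ord.{u} n) (Ord.{u} m)).2 (f i, g i)
      refine ⟨fun i => T.map (↾e') (t i), ⟨?_, ?_⟩, ?_⟩
      · funext i
        exact (h₁ (t i)).trans (congrArg Prod.fst (ht i))
      · funext i
        exact (h₂ (t i)).trans (congrArg Prod.snd (ht i))
      · rintro l ⟨rfl, rfl⟩
        funext i
        rw [← hee (l i)]
        refine congrArg _ ((hbc _ _).1 ?_)
        rw [ht]
        refine Prod.ext ?_ ?_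
        · rw [← h₁, hee]
          rfl
        · rw [← h₂, hee]
          rfl

variable {T}
variable {S : Monad (Type u)} (σ : T ⟶ S) {X Y : Type u}

theorem hom_pure (x : X) : σ.app X (pure T x) = pure S x :=
  ConcreteCategory.congr_hom (σ.app_η X) x

theorem hom_map (f : X → Y) (t : T.obj X) :
    σ.app Y (T.map (↾f) t) = S.map (↾f) (σ.app X t) :=
  ConcreteCategory.congr_hom (σ.naturality (↾f)) t

theorem hom_bind (t : T.obj X) (k : X → T.obj Y) :
    σ.app Y (bind T t k) = bind S (σ.app X t) fun x => σ.app Y (k x) := by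
  refine (ConcreteCategory.congr_hom (σ.app_μ Y) (T.map (↾k) t)).trans ?_
  refine congrArg (S.μ.app Y) ?_
  change σ.app (S.obj Y) (T.map (↾(σ.app Y)) (T.map (↾k) t)) = _
  rw [map_map, hom_map]

theorem hom_klTensor {n m p q : ℕ} (f : Fin n → T.obj (Ord.{u} p)) (g : Fin m → T.obj (Ord.{u} q))
    (c : Fin (n * m)) : σ.app _ (klTensor T f g c) =
      klTensor S (fun i => σ.app _ (f i)) (fun i => σ.app _ (g i)) c := by
  simp only [klTensor_eq, hom_bind, hom_pure]

end SetMonad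

/-- The action of the finitary Kleisli construction on monad morphisms: `f ↦ σ ∘ f`. -/
def klHom {T S : Monad (Type u)} (σ : T ⟶ S) (hT : SetMonad.IsCommutative T)
    (hS : SetMonad.IsCommutative S) : SetMonad.klSMLaw hT ⟶ SetMonad.klSMLaw hS where
  map {n m} (f : Fin n → T.obj (SetMonad.Ord.{u} m)) i := σ.app _ (f i)
  map_id _ := funext fun _ => SetMonad.hom_pure σ _
  map_comp _ _ := funext fun _ => SetMonad.hom_bind σ _ _
  map_inl _ _ := funext fun _ => SetMonad.hom_pure σ _
  map_inr _ _ := funext fun _ => SetMonad.hom_pure σ _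
  map_tensor f g := funext fun c => SetMonad.hom_klTensor σ f g c

/-- The finitary Kleisli functor `ACMnd ⥤ SMBLaw`. -/
def finitaryKleisli : ACMnd.{u} ⥤ SMBLaw.{u} where
  obj T := ⟨SetMonad.klSMLaw T.property.2, SetMonad.klLaw_hasBiproducts T.property.1⟩
  map {T S} σ := ObjectProperty.homMk (klHom σ.hom T.property.2 S.property.2)
  map_id _ := rfl
  map_comp _ _ := rfl

/-- The forgetful functor `SMBLaw ⥤ Law`. -/
def smbLawToLaw : SMBLaw.{u} ⥤ Law.{u} := SMLaw.biproductProperty.ι ⋙ smLawToLaw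

/-! The quotient defining `L.TObj X` only reindexes arguments along functions, so finitely many
classes can always be rewritten over one common family of arguments, and that family may be taken
injective. If `0` is terminal, a class over an injective family determines its operation
(`op_eq_of_cls_eq`). Questions about `L.toMonad` thereby become questions about morphisms of `L`.

Additivity: elements of T_L(X + Y) are written over an argument family v + w with v, w injective.
There the comparison map `bc` is composition of the operation with the two biproduct projections
(`bc_cls`), so it is bijective because p + q is a product in `L`.

Commutativity: for [f, v] and [g, w], both double strengths have the arguments v × w. Their
operations are the two ways to expand f ⊗ g: first f and then copies of g, or the reverse
(`coproj_comp_tensor`, `coproj_comp_tensor'`). Bifunctoriality makes the two equal.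

Adjunction: the unit sends g : n → m to its components, each regarded as an element of T_L(m) with
the identity as arguments. It preserves the tensor by the same expansion of f ⊗ g. The counit
evaluates: [g, v] goes to T(v)(g). Both triangle identities reduce to the unit laws. -/

/-! ### Additivity of the monad of a Lawvere theory with biproducts. -/

namespace Law

variable {L : Law.{u}} {X Y Z : Type u}

/-- Kleisli extension for `T_L`, computed on simultaneous representatives. -/
theorem bind_cls {i p : ℕ} (g : L.Hom 1 i) (v : Fin i → X) (k : X → L.toMonad.obj Y)
    (h : Fin i → L.Hom 1 p) (w : Fin p → Y) (H : ∀ a, k (v a) = cls (h a) w) :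
    SetMonad.bind L.toMonad (cls g v) k = cls (L.comp g (L.cotuple h)) w :=
  TMul_cls g (fun a => k (v a)) h w H

/-- Over injective arguments a class determines the operation. -/
theorem op_eq_of_cls_eq (h0 : ∀ n, ∃! _f : L.Hom n 0, True) {n : ℕ} {g g' : L.Hom 1 n}
    {v : Fin n → X} (hv : Function.Injective v) (h : cls g v = cls g' v) : g = g' := by
  -- The case n = 0 is separate because the left inverse used below needs `Fin n` to be inhabited;
  -- here L(1, 0) is a singleton.
  rcases Nat.eq_zero_or_pos n with rfl | hn
  · exact (h0 1).unique trivial trivial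
  obtain ⟨q, w, e, e', h₁, h₂, h₃⟩ := span_of_eq h
  -- The family w of the common refinement may have repetitions, so e and e' may differ. Factoring w
  -- through an injective z identifies them, and the resulting function is injective because v is.
  obtain ⟨r, z, c, hz, hc⟩ := exists_inj (κ := Unit) (fun _ => q) (fun _ => w)
  have hee : (fun a => c () (e a)) = fun a => c () (e' a) := by
    funext a
    apply hz
    rw [hc, hc, h₁, h₂]
  have hinj : Function.Injective fun a => c () (e a) := fun a b hab => by
    apply hv
    have := congrArg z hab
    simp only [hc] at this
    exact (h₁ a).symm.trans (this.trans (h₁ b))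
  have : Nonempty (Fin n) := ⟨⟨0, hn⟩⟩
  obtain ⟨d, hd⟩ := hinj.hasLeftInverse
  -- Composing with c and then with the left inverse d cancels the common reindexing from both
  -- operations.
  have key := congrArg (fun x => L.comp (L.comp x (L.ι (c ()))) (L.ι d)) h₃
  dsimp only at key
  rw [L.assoc g (L.ι e), L.assoc g' (L.ι e'), ← L.ι_comp e, ← L.ι_comp e', ← hee, L.assoc, L.assoc,
    ← L.ι_comp] at key
  have hid : (fun i => d (c () (e i))) = fun i => i := funext hd
  rwa [hid, L.ι_id, L.comp_id, L.comp_id] at key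

/-- Arguments in the empty set force arity 0, and terminality of `0` leaves a single operation 1 →
0. -/
theorem unique_TObj_empty (h0 : ∀ n, ∃! _f : L.Hom n 0, True) :
    Nonempty (Unique (L.TObj PEmpty.{u + 1})) := by
  refine ⟨⟨⟨cls (h0 1).choose fun a => a.elim0⟩, fun t => ?_⟩⟩
  induction t using cls_ind with | h i g v =>
  obtain rfl : i = 0 := by
    rcases i with - | i
    · rfl
    · exact (v 0).elim
  rw [(h0 1).unique (y₁ := g) (y₂ := (h0 1).choose) trivial trivial]
  exact congrArg _ (funext fun a => a.elim0)

theorem IsZero.precomp {k l m : ℕ} {g : L.Hom l m} (hg : L.IsZero g) (f : L.Hom k l) :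
    L.IsZero (L.comp f g) := by
  obtain ⟨a, b, rfl⟩ := hg
  exact ⟨L.comp f a, b, (L.assoc _ _ _).symm⟩

/-- A map through `0` ends with the image of the empty function, which the relation moves onto the
arguments. What remains is an operation of arity 0, that is, the only element of T_L(∅); hence
neither v nor x matters. -/
theorem zero_eq_cls (h : Nonempty (Unique (L.toMonad.obj PEmpty.{u + 1}))) {n : ℕ}
    {f : L.Hom 1 n} (hf : L.IsZero f) (v : Fin n → Y) (x : X) :
    SetMonad.zero (T := L.toMonad) h x = cls f v := by
  obtain ⟨a, b, rfl⟩ := hf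
  have hb : b = L.ι Fin.elim0 := (L.initial n).unique trivial trivial
  have hu : (Classical.choice h).default = cls a (fun i => i.elim0) :=
    ((Classical.choice h).uniq _).symm
  rw [hb, cls_ι, SetMonad.zero, hu]
  exact congrArg (cls a) (funext fun i => i.elim0)

/-- The arguments `v + w : p + q → X + Y`. -/
def sumArg {p q : ℕ} (v : Fin p → X) (w : Fin q → Y) (c : Fin (p + q)) : X ⊕ Y :=
  Fin.addCases (fun a => Sum.inl (v a)) (fun b => Sum.inr (w b)) c

/-- Translates `bc` into composition with the projections. On each generator of p + q the Kleisli
maps `p₁`, `p₂` are a unit or a zero, exactly as the components of π₁, π₂ are a coprojection or a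
zero map. -/
theorem bc_cls (h : Nonempty (Unique (L.toMonad.obj PEmpty.{u + 1}))) {p q : ℕ}
    {π₁ : L.Hom (p + q) p} {π₂ : L.Hom (p + q) q} (hπ : L.IsProjections π₁ π₂)
    (v : Fin p → X) (w : Fin q → Y) (g : L.Hom 1 (p + q)) :
    SetMonad.bc (T := L.toMonad) h (cls g (sumArg v w)) =
      (cls (L.comp g π₁) v, cls (L.comp g π₂) w) := by
  have hcot : ∀ {k} (π : L.Hom (p + q) k), (L.cotuple fun c => L.comp (L.coproj c) π) = π :=
    fun π => (L.eq_cotuple fun _ => rfl).symm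
  refine Prod.ext ?_ ?_
  · refine (bind_cls g _ (SetMonad.p₁ h) (fun c => L.comp (L.coproj c) π₁) v ?_).trans ?_
    · refine fun c => Fin.addCases (fun a => ?_) (fun b => ?_) c
      · rw [← L.coproj_comp_ι, L.assoc, hπ.inl_fst, L.comp_id, cls_coproj, sumArg,
          Fin.addCases_left]
        rfl
      · rw [← L.coproj_comp_ι, L.assoc, sumArg, Fin.addCases_right]
        exact zero_eq_cls h (hπ.inr_fst.precomp _) v (w b)
    · rw [hcot]
  · refine (bind_cls g _ (SetMonad.p₂ h) (fun c => L.comp (L.coproj c) π₂) w ?_).trans ?_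
    · refine fun c => Fin.addCases (fun a => ?_) (fun b => ?_) c
      · rw [← L.coproj_comp_ι, L.assoc, sumArg, Fin.addCases_left]
        exact zero_eq_cls h (hπ.inl_snd.precomp _) w (v a)
      · rw [← L.coproj_comp_ι, L.assoc, hπ.inr_snd, L.comp_id, cls_coproj, sumArg,
          Fin.addCases_right]
        rfl
    · rw [hcot]

/-- Two elements of `T_L(X + Y)` have representatives with the same arguments, which are the sum of
two injective families. -/
theorem exists_sumArg (s t : L.TObj (X ⊕ Y)) :
    ∃ (p q : ℕ) (v : Fin p → X) (w : Fin q → Y) (f g : L.Hom 1 (p + q)),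
      Function.Injective v ∧ Function.Injective w ∧
        s = cls f (sumArg v w) ∧ t = cls g (sumArg v w) := by
  induction s using cls_ind with | h i f x =>
  induction t using cls_ind with | h j g y =>
  have hfin : (Set.range x ∪ Set.range y).Finite :=
    (Set.finite_range x).union (Set.finite_range y)
  -- The left and right parts of all the arguments that occur are enumerated separately without
  -- repetition; each of the two terms is then reindexed along d or e.
  obtain ⟨p, v, hv, hrv⟩ := (hfin.preimage Sum.inl_injective.injOn).fin_param
  obtain ⟨q, w, hw, hrw⟩ := (hfin.preimage Sum.inr_injective.injOn).fin_param
  have key : ∀ z ∈ Set.range x ∪ Set.range y, ∃ c : Fin (p + q), sumArg v w c = z := by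
    rintro (z | z) hz
    · obtain ⟨a, rfl⟩ : z ∈ Set.range v := hrv ▸ hz
      exact ⟨Fin.castAdd q a, Fin.addCases_left a⟩
    · obtain ⟨b, rfl⟩ : z ∈ Set.range w := hrw ▸ hz
      exact ⟨Fin.natAdd p b, Fin.addCases_right b⟩
  choose d hd using fun a => key (x a) (Or.inl ⟨a, rfl⟩)
  choose e he using fun a => key (y a) (Or.inr ⟨a, rfl⟩)
  refine ⟨p, q, v, w, L.comp f (L.ι d), L.comp g (L.ι e), hv, hw, ?_, ?_⟩
  · rw [cls_ι]
    exact congrArg (cls f) (funext fun a => (hd a).symm)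
  · rw [cls_ι]
    exact congrArg (cls g) (funext fun a => (he a).symm)

theorem isAdditive_toMonad (hL : L.HasBiproducts) : SetMonad.IsAdditive L.toMonad := by
  have h := unique_TObj_empty hL.terminal
  refine ⟨h, fun X Y => ⟨fun s t hst => ?_, fun ⟨s, t⟩ => ?_⟩⟩
  -- Injectivity: equal images give equal composites with both projections, since v and w are
  -- injective, and the product property gives f = g.
  · obtain ⟨p, q, v, w, f, g, hv, hw, rfl, rfl⟩ := exists_sumArg s t
    obtain ⟨π₁, π₂, hπ, huniv⟩ := hL.biproduct p q
    rw [bc_cls h hπ, bc_cls h hπ] at hst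
    have h₁ := op_eq_of_cls_eq hL.terminal hv (congrArg Prod.fst hst)
    have h₂ := op_eq_of_cls_eq hL.terminal hw (congrArg Prod.snd hst)
    rw [(huniv _ _).unique ⟨h₁, h₂⟩ ⟨rfl, rfl⟩]
  -- Surjectivity: the preimage is the pairing of the two operations in the product p + q, over the
  -- arguments v + w.
  · induction s using cls_ind with | h p f v =>
    induction t using cls_ind with | h q g w =>
    obtain ⟨π₁, π₂, hπ, huniv⟩ := hL.biproduct p q
    obtain ⟨k, ⟨rfl, rfl⟩, -⟩ := huniv f g
    exact ⟨cls k (sumArg v w), bc_cls h hπ v w k⟩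

end Law

/-! ### Components of the tensor, and commutativity of the monad. -/

namespace SMLaw

variable (L : SMLaw.{u})

/-- Up to the left unit isomorphism, the inclusion b ↦ (a, b) is κ_a ⊗ id. By bifunctoriality,
following it by id ⊗ f or preceding it by id₁ ⊗ f gives κ_a ⊗ f in both cases; naturality of the
left unit turns id₁ ⊗ f into f. -/
theorem coproj_tensor {n m p : ℕ} (a : Fin n) (f : L.Hom m p) :
    L.comp (L.ι fun b => co.symm (a, b)) (L.tensor (L.id n) f) =
      L.comp f (L.ι fun b => co.symm (a, b)) := by
  have hι : ∀ k, L.comp (L.ι (finLeft k)) (L.ι fun b => co.symm (a, b)) =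
      L.tensor (L.coproj a) (L.id k) := fun k => by
    rw [← L.ι_id, Law.coproj, L.tensor_ι, ← L.ι_comp]
    rfl
  have hinv : ∀ k, L.comp (L.ι fun b : Fin k => co.symm ((0 : Fin 1), b)) (L.ι (finLeft k)) =
      L.id k := fun k => by
    rw [← L.ι_comp, ← L.ι_id]
    simp only [finLeft, Equiv.apply_symm_apply]
  have key : L.comp (L.ι (finLeft m)) (L.comp (L.ι fun b => co.symm (a, b))
      (L.tensor (L.id n) f)) = L.comp (L.ι (finLeft m)) (L.comp f (L.ι fun b => co.symm (a, b))) := by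
    rw [← L.assoc, hι, ← L.assoc, ← L.left_natural, L.assoc, hι, ← L.tensor_comp, ← L.tensor_comp,
      L.id_comp, L.id_comp, L.comp_id, L.comp_id]
  -- Precomposition with the inverse of the left unit isomorphism removes it from `key`.
  have := congrArg (L.comp (L.ι fun b : Fin m => co.symm ((0 : Fin 1), b))) key
  rwa [← L.assoc, hinv, ← L.assoc (L.ι fun b : Fin m => co.symm ((0 : Fin 1), b)), hinv, L.id_comp,
    L.id_comp] at this

/-- The mirror image of `coproj_tensor`, obtained by naturality of the swap. -/
theorem tensor_coproj {n m p : ℕ} (f : L.Hom n p) (b : Fin m) :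
    L.comp (L.ι fun a => co.symm (a, b)) (L.tensor f (L.id m)) =
      L.comp f (L.ι fun a => co.symm (a, b)) := by
  have hswap : ∀ k, L.comp (L.ι fun a : Fin k => co.symm (b, a)) (L.ι (finSwap m k)) =
      L.ι fun a => co.symm (a, b) := fun k => by
    rw [← L.ι_comp]
    simp only [finSwap, Equiv.apply_symm_apply]
  rw [← hswap, L.assoc, ← L.swap_natural, ← L.assoc, coproj_tensor, L.assoc, hswap]

/-- The components of a tensor product of maps out of `n * m`. -/
theorem coproj_comp_tensor {n m p q : ℕ} (f : L.Hom n p) (g : L.Hom m q) (c : Fin (n * m)) :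
    L.comp (L.coproj c) (L.tensor f g) = L.comp (L.comp (L.coproj (co c).1) f)
      (L.cotuple fun a => L.comp (L.comp (L.coproj (co c).2) g) (L.ι fun b => co.symm (a, b))) := by
  have h₁ : L.comp (L.coproj (co c).1) (L.ι fun a => co.symm (a, (co c).2)) = L.coproj c := by
    rw [L.coproj_comp_ι]
    exact congrArg _ (co.symm_apply_apply c)
  -- This factorisation performs f first; the opposite one yields the other expansion.
  have h₂ : L.tensor f g = L.comp (L.tensor f (L.id m)) (L.tensor (L.id p) g) := by
    rw [← L.tensor_comp, L.comp_id, L.id_comp]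
  rw [h₂, ← h₁, L.assoc, ← L.assoc (L.ι _), tensor_coproj, ← L.assoc, ← L.assoc, L.assoc]
  congr 1
  refine L.eq_cotuple fun a => ?_
  -- Both sides are the coprojection at the pair (a, (co c).2), reached along a column or along a
  -- row.
  have h₃ : L.comp (L.coproj a) (L.ι fun a => co.symm (a, (co c).2)) =
      L.comp (L.coproj (co c).2) (L.ι fun b => co.symm (a, b)) := by
    rw [L.coproj_comp_ι, L.coproj_comp_ι]
  rw [← L.assoc, h₃, L.assoc, coproj_tensor, L.assoc]

/-- The components of a tensor product of maps out of `n * m`, in the other order. -/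
theorem coproj_comp_tensor' {n m p q : ℕ} (f : L.Hom n p) (g : L.Hom m q) (c : Fin (n * m)) :
    L.comp (L.coproj c) (L.tensor f g) = L.comp (L.comp (L.coproj (co c).2) g)
      (L.cotuple fun b => L.comp (L.comp (L.coproj (co c).1) f) (L.ι fun a => co.symm (a, b))) := by
  have h₁ : L.comp (L.coproj (co c).2) (L.ι fun b => co.symm ((co c).1, b)) = L.coproj c := by
    rw [L.coproj_comp_ι]
    exact congrArg _ (co.symm_apply_apply c)
  have h₂ : L.tensor f g = L.comp (L.tensor (L.id n) g) (L.tensor f (L.id q)) := by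
    rw [← L.tensor_comp, L.comp_id, L.id_comp]
  rw [h₂, ← h₁, L.assoc, ← L.assoc (L.ι _), coproj_tensor, ← L.assoc, ← L.assoc, L.assoc]
  congr 1
  refine L.eq_cotuple fun b => ?_
  have h₃ : L.comp (L.coproj b) (L.ι fun b => co.symm ((co c).1, b)) =
      L.comp (L.coproj (co c).1) (L.ι fun a => co.symm (a, b)) := by
    rw [L.coproj_comp_ι, L.coproj_comp_ι]
  rw [← L.assoc, h₃, L.assoc, tensor_coproj, L.assoc]

variable {L} {X Y : Type u}

/-- The explicit form of `dst`, shaped to match `coproj_comp_tensor`. For fixed a, the inner class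
is reindexed along b ↦ (a, b), so that all of them share the arguments v × w. -/
theorem bind_bind_cls {p q : ℕ} (f : L.Hom 1 p) (g : L.Hom 1 q) (v : Fin p → X) (w : Fin q → Y) :
    (SetMonad.bind L.toMonad (Law.cls f v) fun x => SetMonad.bind L.toMonad (Law.cls g w) fun y =>
      SetMonad.pure L.toMonad (x, y)) =
    Law.cls (L.comp f (L.cotuple fun a => L.comp g (L.ι fun b => co.symm (a, b))))
      fun c => (v (co c).1, w (co c).2) := by
  refine Law.bind_cls _ _ _ _ _ fun a => ?_
  rw [Law.cls_ι]
  refine (SetMonad.map_eq_bind L.toMonad (fun y => (v a, y)) (Law.cls g w)).symm.trans ?_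
  simp only [Equiv.apply_symm_apply]
  rfl

theorem bind_bind_cls' {p q : ℕ} (f : L.Hom 1 p) (g : L.Hom 1 q) (v : Fin p → X) (w : Fin q → Y) :
    (SetMonad.bind L.toMonad (Law.cls g w) fun y => SetMonad.bind L.toMonad (Law.cls f v) fun x =>
      SetMonad.pure L.toMonad (x, y)) =
    Law.cls (L.comp g (L.cotuple fun b => L.comp f (L.ι fun a => co.symm (a, b))))
      fun c => (v (co c).1, w (co c).2) := by
  refine Law.bind_cls _ _ _ _ _ fun b => ?_
  rw [Law.cls_ι]
  refine (SetMonad.map_eq_bind L.toMonad (fun x => (x, w b)) (Law.cls f v)).symm.trans ?_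
  simp only [Equiv.apply_symm_apply]
  rfl

theorem isCommutative_toMonad : SetMonad.IsCommutative L.toMonad := by
  rintro X Y ⟨s, t⟩
  induction s using Law.cls_ind with | h p f v =>
  induction t using Law.cls_ind with | h q g w =>
  refine (SetMonad.dst_eq L.toMonad _ _).trans (((bind_bind_cls f g v w).trans ?_).trans
    ((SetMonad.dst'_eq L.toMonad _ _).trans (bind_bind_cls' f g v w)).symm)
  -- Since f and g have source 1, f ⊗ g has source 1 * 1 and a single component, at (0, 0). Its two
  -- expansions are the operations to be compared.
  have h := (L.coproj_comp_tensor f g (co.symm (0, 0))).symm.trans (L.coproj_comp_tensor' f g _)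
  simp only [Equiv.apply_symm_apply, L.coproj_zero, L.id_comp] at h
  rw [h]

end SMLaw

/-! ### The unit of the adjunction. -/

namespace Law

variable (L : Law.{u})

/-- The unit of the adjunction on underlying Lawvere theories: `g : n → m` is sent to the function
`i ↦ [κ_m(g ∘ κ_i, id)]`. -/
noncomputable def klUnit : LawHom L (SetMonad.klLaw L.toMonad) where
  map {n m} g i := cls (L.comp (L.coproj i) g) (ULift.up : Fin m → SetMonad.Ord.{u} m)
  map_id n := funext fun i => by
    rw [L.comp_id]
    exact cls_coproj i _
  map_comp f g := funext fun i => by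
    refine Eq.trans ?_ (bind_cls _ _ _ (fun a => L.comp (L.coproj a) g) _ fun _ => rfl).symm
    -- The cotuple of the components of g is g itself, so Kleisli composition is composition in `L`.
    rw [← L.eq_cotuple fun _ => rfl, L.assoc]
  map_inl n m := funext fun i => by
    rw [L.coproj_comp_ι]
    exact cls_coproj _ _
  map_inr n m := funext fun i => by
    rw [L.coproj_comp_ι]
    exact cls_coproj _ _

end Law

/-- The unit of the adjunction: it preserves the tensor. -/
noncomputable def SMLaw.klUnit (L : SMLaw.{u}) :
    L ⟶ SetMonad.klSMLaw (T := L.toMonad) L.isCommutative_toMonad where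
  toLawHom := L.toLaw.klUnit
  map_tensor {n m p q} f g := funext fun c => by
    refine Eq.trans ?_ (congrArg (L.toMonad.map (↾fun z : SetMonad.Ord.{u} p × SetMonad.Ord.{u} q =>
      ULift.up (co.symm (z.1.down, z.2.down)))) ((SetMonad.dst_eq L.toMonad _ _).trans
        (bind_bind_cls _ _ _ _))).symm
    change Law.cls _ _ = Law.cls _ _
    -- The operation computed by the Kleisli tensor is the expansion of the component of f ⊗ g at c;
    -- the arguments agree because `co.symm` inverts `co`.
    rw [← coproj_comp_tensor]
    exact congrArg (Law.cls _) (funext fun d =>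
      congrArg ULift.up (co.symm_apply_apply d).symm)

/-! ### The counit of the adjunction. -/

namespace SetMonad

variable (T : Monad (Type u)) {X Y : Type u}

/-- The components `[κᵢ(g, v)] ↦ T(v)(g)` of the counit of the adjunction. -/
def klCounitApp : (klLaw T).TObj X → T.obj X :=
  Quot.lift (fun t => T.map (↾fun j : Ord.{u} t.arity => t.arg j.down) (t.op 0)) (by
    rintro _ _ ⟨f, g, v⟩
    -- In the Kleisli category, composing with a function extends along a map into units, so
    -- evaluation respects the relation by functoriality of T.
    change T.map _ (bind T (g 0) _) = T.map _ (g 0)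
    rw [map_bind, map_eq_bind]
    exact congrArg (bind T (g 0)) (funext fun j => map_pure T _ _))

theorem klCounitApp_cls {i : ℕ} (g : (klLaw T).Hom 1 i) (v : Fin i → X) :
    klCounitApp T (Law.cls g v) = T.map (↾fun j : Ord.{u} i => v j.down) (g 0) := rfl

theorem coproj_klLaw_comp {n m : ℕ} (i : Fin n) (f : (klLaw T).Hom n m) (j : Fin 1) :
    (klLaw T).comp ((klLaw T).coproj i) f j = f i := pure_bind T _ _

/-- Over simultaneous representatives t(j) = [h_j, v], both sides extend g 0 along j ↦ T(v)(h_j),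
because the j-th value of the cotuple of the h's is h_j. -/
theorem klCounitApp_TMul (t : (klLaw T).TObj ((klLaw T).TObj X)) :
    klCounitApp T (Law.TMul t) = bind T (klCounitApp T t) (klCounitApp T) := by
  induction t using Law.cls_ind with | h i g t =>
  obtain ⟨p, h, v, H⟩ := Law.exists_simul t
  rw [Law.TMul_cls g t h v H, klCounitApp_cls, klCounitApp_cls, bind_map]
  refine (map_bind T _ _ _).trans (congrArg (bind T (g 0)) (funext fun j => ?_))
  rw [H, klCounitApp_cls, ← (klLaw T).coproj_cotuple h j.down]
  exact congrArg _ (coproj_klLaw_comp T j.down _ 0).symm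

/-- The counit of the adjunction. -/
def klCounit : (klLaw T).toMonad ⟶ T where
  app X := ↾(klCounitApp T)
  naturality X Y f := by
    ext t
    induction t using Law.cls_ind with | h i g v =>
    exact (map_map T _ _ _).symm
  app_η X := by
    ext x
    exact map_pure T _ _
  app_μ X := by
    ext t
    refine (klCounitApp_TMul T t).trans ?_
    -- The remaining difference is whether the counit is applied to the arguments before or after
    -- evaluation; functoriality of T identifies the two.
    induction t using Law.cls_ind with | h i g v =>
    change T.μ.app X (T.map _ (T.map _ _)) = T.μ.app X (T.map _ _)
    rw [map_map]

end SetMonad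

/-! ### The restricted functor and the adjunction. -/

/-- The functor `SMBLaw ⥤ ACMnd` that sends `L` to `T_L`. -/
noncomputable def smbLawToACMnd : SMBLaw.{u} ⥤ ACMnd.{u} :=
  acMonadProperty.lift (smbLawToLaw ⋙ lawToMonad) fun L =>
    ⟨Law.isAdditive_toMonad L.property, SMLaw.isCommutative_toMonad⟩

/-- The functor `L ↦ T_L` is left adjoint to the finitary Kleisli functor. -/
noncomputable def smbLawAdjunction : smbLawToACMnd.{u} ⊣ finitaryKleisli.{u} :=
  Adjunction.mkOfUnitCounit
    { unit :=
        { app := fun L => ObjectProperty.homMk L.obj.klUnit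
          naturality := fun L K F => by
            apply ObjectProperty.hom_ext
            apply SMLawHom.ext
            funext n m g
            funext i
            refine Eq.trans ?_ (congrArg (fun f => Law.cls f _)
              (LawHom.map_comp F.hom.toLawHom (L.obj.coproj i) g)).symm
            rw [LawHom.map_coproj]
            rfl }
      counit :=
        { app := fun T => ObjectProperty.homMk (SetMonad.klCounit T.obj)
          naturality := fun T S σ => by
            apply ObjectProperty.hom_ext
            ext X t
            induction t using Law.cls_ind with | h i g v =>
            exact (SetMonad.hom_map σ.hom _ _).symm }
      left_triangle := by
        ext L : 2
        apply ObjectProperty.hom_ext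
        ext X t
        induction t using Law.cls_ind with | h i g v =>
        -- The unit records g through its only component, along the coprojection 1 → 1, which is the
        -- identity.
        change Law.cls (L.obj.comp (L.obj.coproj 0) g) v = Law.cls g v
        rw [L.obj.coproj_zero]
        exact congrArg (fun f => Law.cls f v) (L.obj.id_comp g)
      right_triangle := by
        ext T : 2
        apply ObjectProperty.hom_ext
        apply SMLawHom.ext
        funext n m g
        funext i
        -- The unit supplies the identity as arguments, so the counit applies T to an identity, and
        -- precomposition with κ_i evaluates g at i.
        change T.obj.map (𝟙 _) ((SetMonad.klLaw T.obj).comp _ g 0) = g i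
        rw [T.obj.map_id]
        exact SetMonad.coproj_klLaw_comp T.obj i g 0 }

/-- The monad `T_L` of a symmetric monoidal Lawvere theory `L` with biproducts is additive and
commutative; the resulting restriction `SMBLaw ⥤ ACMnd` of the functor `L ↦ T_L` is left adjoint to
the finitary Kleisli functor `ACMnd ⥤ SMBLaw`. -/
theorem mainTheorem4 :
    ∃ h : ∀ L : SMBLaw.{u},
        SetMonad.IsAdditive (L.obj.toLaw.toMonad) ∧ SetMonad.IsCommutative (L.obj.toLaw.toMonad),
      Nonempty (acMonadProperty.{u}.lift (smbLawToLaw.{u} ⋙ lawToMonad.{u}) h ⊣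
        finitaryKleisli.{u}) :=
  ⟨_, ⟨smbLawAdjunction⟩⟩
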